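/- Let $D$ be a co-Heyting algebra, i.e. a bounded distributive lattice with an operation $/$ satisfying $a/b\le c \iff a\le b\vee c$, and let $D^-$ be its Booleanization (the free Boolean extension $D\hookrightarrow D^-$, through which every bounded lattice homomorphism from $D$ into a Boolean algebra factors uniquely). For $x,y\in D^-$ write $x-y=x\wedge\neg y$, and for $b\in D^-$ let $\lceil b\rceil\in D$ be the least $c\in D$ with $b\le c$ (it exists since $D$ is a co-Heyting algebra). Fix $b\in D^-$ and define a sequence in $D$ by $$a_1=\lceil b\rceil,\qquad a_{2i}=\lceil a_{2i-1}-b\rceil,\qquad a_{2i+1}=\lceil a_{2i}\wedge b\rceil\qquad(i\ge 1).$$ Then the sequence $(a_i)_{i\ge1}$ is decreasing, and there exists $m\ge1$ with $a_{2m+1}=0$. Let $m$ be the least such number. Then $a_j=0$ for all $j\ge 2m+1$ and $$b=a_1-(a_2-(\cdots-(a_{2m-1}-a_{2m})\cdots)).$$ Moreover, whenever $p\ge1$ and $c_1\ge c_2\ge\dots\ge c_{2p}$ are elements of $D$ with $$b=c_1-(c_2-(\cdots-(c_{2p-1}-c_{2p})\cdots)),$$ we have $p\ge m$, $c_i\ge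 a_i$ for all $i\in\{1,\dots,2p\}$, and for each $n\le m$ $$\bigvee_{i=1}^n(c_{2i-1}-c_{2i})\ \le\ \bigvee_{i=1}^n(a_{2i-1}-a_{2i}).$$ -/

import Mathlib

namespace DiffHier

open Order

/-- The underlying set of the dual space of a lattice: its (proper) prime filters. -/
def PrimeFilter (D : Type*) [DistribLattice D] [BoundedOrder D] : Type _ :=
  {x : PFilter D // x.IsPrime}

namespace PrimeFilter

variable {D : Type*} [DistribLattice D] [BoundedOrder D]

theorem top_mem (x : PrimeFilter D) : (⊤ : D) ∈ x.1 := PFilter.top_mem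

theorem bot_notMem (x : PrimeFilter D) : (⊥ : D) ∉ x.1 := by
  intro h
  obtain ⟨a, ha⟩ := x.2.compl_ideal.Nonempty
  exact ha (PFilter.mem_of_le bot_le h)

theorem inf_mem_iff (x : PrimeFilter D) (a b : D) : a ⊓ b ∈ x.1 ↔ a ∈ x.1 ∧ b ∈ x.1 :=
  PFilter.inf_mem_iff

theorem sup_mem_iff (x : PrimeFilter D) (a b : D) : a ⊔ b ∈ x.1 ↔ a ∈ x.1 ∨ b ∈ x.1 := by
  constructor
  · intro h
    by_contra! hn
    obtain ⟨c, hc, hac, hbc⟩ := x.2.compl_ideal.Directed a hn.1 b hn.2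
    exact hc (PFilter.mem_of_le (sup_le hac hbc) h)
  · rintro (h | h)
    · exact PFilter.mem_of_le le_sup_left h
    · exact PFilter.mem_of_le le_sup_right h

/-- A set of elements closed under the rules for prime filters is a prime filter. -/
def ofSet (s : Set D) (top : ⊤ ∈ s) (bot : ⊥ ∉ s)
    (inf : ∀ a b, a ⊓ b ∈ s ↔ a ∈ s ∧ b ∈ s) (sup : ∀ a b, a ⊔ b ∈ s ↔ a ∈ s ∨ b ∈ s) :
    PrimeFilter D :=
  have up : ∀ {a b : D}, a ≤ b → a ∈ s → b ∈ s := fun {a b} hab ha => by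
    rw [← sup_eq_right.2 hab]
    exact (sup a b).2 (Or.inl ha)
  have hf : IsPFilter s := IsPFilter.of_def ⟨⊤, top⟩
    (fun a ha b hb => ⟨a ⊓ b, (inf a b).2 ⟨ha, hb⟩, inf_le_left, inf_le_right⟩)
    (fun {_ _} hab ha => up hab ha)
  ⟨hf.toPFilter, ⟨{
    IsLowerSet := fun _ _ hab ha hb => ha (up hab hb)
    Nonempty := ⟨⊥, bot⟩
    Directed := fun a ha b hb =>
      ⟨a ⊔ b, fun h => ((sup a b).1 h).elim ha hb, le_sup_left, le_sup_right⟩ }⟩⟩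

theorem mem_ofSet (s : Set D) (top : ⊤ ∈ s) (bot : ⊥ ∉ s)
    (inf : ∀ a b, a ⊓ b ∈ s ↔ a ∈ s ∧ b ∈ s) (sup : ∀ a b, a ⊔ b ∈ s ↔ a ∈ s ∨ b ∈ s) (a : D) :
    a ∈ (ofSet s top bot inf sup).1 ↔ a ∈ s := Iff.rfl

/-- Distinct elements are separated by prime filters. -/
theorem exists_separating {a b : D} (h : ¬ a ≤ b) :
    ∃ x : PrimeFilter D, a ∈ x.1 ∧ b ∉ x.1 := by
  have hd : Disjoint (PFilter.principal a : Set D) (Ideal.principal b : Set D) := by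
    rw [Set.disjoint_left]
    intro c hc hc'
    exact h (le_trans (PFilter.mem_principal.1 hc) (Ideal.mem_principal.1 hc'))
  obtain ⟨J, hJ, hbJ, hJF⟩ := DistribLattice.prime_ideal_of_disjoint_filter_ideal hd
  have hb : b ∈ J := hbJ (Ideal.mem_principal.2 le_rfl)
  have ha : a ∉ J := fun haJ =>
    Set.disjoint_left.1 hJF (PFilter.mem_principal.2 le_rfl : a ∈ PFilter.principal a) haJ
  refine ⟨⟨hJ.toPrimePair.F, hJ.toPrimePair.F_isPrime⟩, ?_, ?_⟩
  · change a ∈ (hJ.toPrimePair.F : Set D)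
    rw [← hJ.toPrimePair.compl_I_eq_F]
    exact ha
  · change b ∉ (hJ.toPrimePair.F : Set D)
    rw [← hJ.toPrimePair.compl_I_eq_F]
    exact fun hn => hn hb

end PrimeFilter

section Booleanization

variable (D : Type*) [DistribLattice D] [BoundedOrder D]

/-- The Stone map `a ↦ {x | a ∈ x}` into the powerset of the set of prime filters. -/
def stone : BoundedLatticeHom D (Set (PrimeFilter D)) where
  toFun a := {x | a ∈ x.1}
  map_sup' a b := by ext x; exact x.sup_mem_iff a b
  map_inf' a b := by ext x; exact x.inf_mem_iff a b
  map_top' := by ext x; exact iff_of_true x.top_mem trivial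
  map_bot' := by ext x; exact iff_of_false x.bot_notMem (fun h => h)

/-- The Booleanization `D⁻` of a bounded distributive lattice `D`: the Boolean algebra of sets of
prime filters generated by the image of the Stone map. -/
def Booleanization : Type _ :=
  (BooleanSubalgebra.closure (Set.range (stone D)) : BooleanSubalgebra (Set (PrimeFilter D)))

instance : BooleanAlgebra (Booleanization D) :=
  inferInstanceAs (BooleanAlgebra (BooleanSubalgebra.closure (Set.range (stone D)) :
    BooleanSubalgebra (Set (PrimeFilter D))))

/-- The canonical map `D → D⁻`. -/
def incl : BoundedLatticeHom D (Booleanization D) where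
  toFun a := ⟨stone D a, BooleanSubalgebra.subset_closure ⟨a, rfl⟩⟩
  map_sup' a b := Subtype.ext (map_sup (stone D) a b)
  map_inf' a b := Subtype.ext (map_inf (stone D) a b)
  map_top' := Subtype.ext (map_top (stone D))
  map_bot' := Subtype.ext (map_bot (stone D))

variable {D}

theorem stone_le_stone_iff {a b : D} : stone D a ≤ stone D b ↔ a ≤ b := by
  refine ⟨fun h => ?_, fun h => OrderHomClass.mono (stone D) h⟩
  by_contra hn
  obtain ⟨x, ha, hb⟩ := PrimeFilter.exists_separating hn
  exact hb (h ha)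

/-- `D → D⁻` is an embedding. -/
theorem incl_le_incl_iff {a b : D} : incl D a ≤ incl D b ↔ a ≤ b := stone_le_stone_iff

theorem stone_injective : Function.Injective (stone D) := fun _ _ h =>
  le_antisymm (stone_le_stone_iff.1 h.le) (stone_le_stone_iff.1 h.ge)

theorem incl_injective : Function.Injective (incl D) := fun _ _ h =>
  le_antisymm (incl_le_incl_iff.1 h.le) (incl_le_incl_iff.1 h.ge)

theorem isSublattice_range_stone : IsSublattice (Set.range (stone D)) where
  supClosed := by
    rintro _ ⟨a, rfl⟩ _ ⟨b, rfl⟩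
    exact ⟨a ⊔ b, map_sup _ _ _⟩
  infClosed := by
    rintro _ ⟨a, rfl⟩ _ ⟨b, rfl⟩
    exact ⟨a ⊓ b, map_inf _ _ _⟩

/-- Every element of `D⁻` is a finite join of differences of elements of `D`. -/
theorem Booleanization.induction {p : Booleanization D → Prop}
    (sdiff : ∀ a b : D, p (incl D a \ incl D b)) (sup : ∀ x y, p x → p y → p (x ⊔ y))
    (x : Booleanization D) : p x := by
  refine BooleanSubalgebra.closure_sdiff_sup_induction
    (p := fun g hg => p (⟨g, hg⟩ : Booleanization D)) isSublattice_range_stone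
    ⟨⊥, map_bot _⟩ ⟨⊤, map_top _⟩ ?_ ?_ x.1 x.2
  · rintro _ ⟨a, rfl⟩ _ ⟨b, rfl⟩
    exact sdiff a b
  · intro x hx y hy
    exact sup ⟨x, hx⟩ ⟨y, hy⟩

/-- The map of dual spaces induced by a bounded lattice homomorphism. -/
def PrimeFilter.comap {C : Type*} [DistribLattice C] [BoundedOrder C] (h : BoundedLatticeHom D C)
    (x : PrimeFilter C) : PrimeFilter D :=
  PrimeFilter.ofSet {a | h a ∈ x.1} (by simp) (by simp [x.bot_notMem])
    (fun a b => by simpa using x.inf_mem_iff (h a) (h b))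
    (fun a b => by simpa using x.sup_mem_iff (h a) (h b))

theorem exists_stone_eq_preimage {C : Type*} [BooleanAlgebra C] (h : BoundedLatticeHom D C)
    (b : Booleanization D) : ∃ c : C, stone C c = PrimeFilter.comap h ⁻¹' b.1 := by
  induction b using Booleanization.induction with
  | sdiff a b =>
    refine ⟨h a \ h b, ?_⟩
    rw [map_sdiff']
    rfl
  | sup x y hx hy =>
    obtain ⟨c, hc⟩ := hx
    obtain ⟨d, hd⟩ := hy
    refine ⟨c ⊔ d, ?_⟩
    rw [map_sup, hc, hd]
    rfl

/-- The universal property of `D → D⁻`: every bounded lattice homomorphism from `D` into a Boolean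
algebra extends uniquely to a homomorphism on `D⁻`. -/
theorem existsUnique_lift {C : Type*} [BooleanAlgebra C] (h : BoundedLatticeHom D C) :
    ∃! g : BoundedLatticeHom (Booleanization D) C, g.comp (incl D) = h := by
  choose f hf using exists_stone_eq_preimage h
  refine ⟨{ toFun := f, map_sup' := ?_, map_inf' := ?_, map_top' := ?_, map_bot' := ?_ }, ?_, ?_⟩
  · intro x y
    apply stone_injective
    rw [map_sup, hf, hf, hf]
    rfl
  · intro x y
    apply stone_injective
    rw [map_inf, hf, hf, hf]
    rfl
  · apply stone_injective
    change stone C (f ⊤) = stone C ⊤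
    rw [map_top, hf]
    rfl
  · apply stone_injective
    change stone C (f ⊥) = stone C ⊥
    rw [map_bot, hf]
    rfl
  · ext a
    apply stone_injective
    exact hf (incl D a)
  · intro g hg
    ext b
    have hincl : ∀ a, g (incl D a) = h a := fun a => DFunLike.congr_fun hg a
    change g b = f b
    apply stone_injective
    rw [hf]
    induction b using Booleanization.induction with
    | sdiff a b =>
      rw [map_sdiff', hincl, hincl, map_sdiff']
      rfl
    | sup x y hx hy =>
      rw [map_sup, map_sup, hx, hy]
      rfl

end Booleanization

section Ceiling

variable {D : Type*} [CoheytingAlgebra D]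

/-- Over a co-Heyting algebra `D`, each element of `D⁻` has a least upper approximation in `D`. -/
theorem exists_isLeast (b : Booleanization D) : ∃ d : D, IsLeast {c : D | b ≤ incl D c} d := by
  induction b using Booleanization.induction with
  | sdiff a b =>
    have key : ∀ c : D, incl D a \ incl D b ≤ incl D c ↔ a \ b ≤ c := fun c => by
      rw [sdiff_le_iff, sdiff_le_iff, ← map_sup, incl_le_incl_iff]
    exact ⟨a \ b, (key _).2 le_rfl, fun c hc => (key c).1 hc⟩
  | sup x y hx hy =>
    obtain ⟨d, hd, hd'⟩ := hx
    obtain ⟨e, he, he'⟩ := hy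
    refine ⟨d ⊔ e, ?_, fun c hc =>
      sup_le (hd' (le_sup_left.trans hc : x ≤ incl D c)) (he' (le_sup_right.trans hc : y ≤ incl D c))⟩
    change x ⊔ y ≤ incl D (d ⊔ e)
    rw [map_sup]
    exact sup_le_sup hd he

/-- The ceiling function `D⁻ → D`: `⌈b⌉` is the least `c ∈ D` with `b ≤ c` in `D⁻`. -/
noncomputable def ceil (b : Booleanization D) : D := (exists_isLeast b).choose

theorem isLeast_ceil (b : Booleanization D) : IsLeast {c : D | b ≤ incl D c} (ceil b) :=
  (exists_isLeast b).choose_spec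

/-- The ceiling function is the lower adjoint of `D → D⁻`. -/
theorem ceil_gc : GaloisConnection (ceil : Booleanization D → D) (incl D) := fun b _ =>
  ⟨fun h => (isLeast_ceil b).1.trans (incl_le_incl_iff.2 h), fun h => (isLeast_ceil b).2 h⟩

end Ceiling

/-- `nestedDiff x k n` is the iterated difference
`x k - (x (k+1) - (… - (x (k+n-2) - x (k+n-1)) …))` of the `n` consecutive terms starting with
`x k`; it is `⊥` for `n = 0`, so that the innermost difference for `n = 1` is `x k - ⊥ = x k`. -/
def nestedDiff {B : Type*} [BooleanAlgebra B] (x : ℕ → B) : ℕ → ℕ → B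
  | _, 0 => ⊥
  | k, n + 1 => x k \ nestedDiff x (k + 1) n

/-- `pairJoin x n` is the join `⋁_{i=1}^n (x (2i-1) - x (2i))`. -/
def pairJoin {B : Type*} [BooleanAlgebra B] (x : ℕ → B) (n : ℕ) : B :=
  (Finset.Icc 1 n).sup fun i => x (2 * i - 1) \ x (2 * i)

end DiffHier

open DiffHier

/-!
Put `sign b j = b` for odd `j` and `sign b j = bᶜ` for even `j`. The recursion defining `a` then reads
`a (j + 1) = ⌈a j ⊓ sign b (j + 1)⌉`, and since the ceiling is a lower adjoint, `a` is the pointwise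
least sequence `x` in `D` with `b ≤ x 1` and `x j ⊓ sign b (j + 1) ≤ x (j + 1)`
(`ceil_sequence_le`). Decreasing sequences with these two properties are said to unravel `b`.

Unravelling sequences are the same thing as representations by iterated differences: a decreasing
sequence vanishing from index `n + 1` on unravels its own iterated difference
(`Unravels.of_nestedDiff`), and conversely an unravelling sequence vanishing at `n + 1` represents `b`
(`Unravels.eq_nestedDiff`). So `a` lies below every representation of `b`, vanishes as soon
as one of them does, and then represents `b` itself. The joins of pairs are compared by the formula
`⋁_{i=1}^n (x (2i-1) - x (2i)) = b - x (2n)`, valid for all unravelling `x` with `n ≥ 1`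
(`Unravels.pairJoin_eq`), whose right side is antitone in `x`.

It remains to see that every `b` has some representation, which forces `a` to vanish eventually. For
decreasing terms the iterated difference is the sum in the Boolean ring `D⁻`. Since `D` generates
`D⁻` as a Boolean ring and is closed under products, each element of `D⁻` is a sum of elements of `D`,
and `y + c = (y ⊔ c) + (y ⊓ c)` allows a new summand to be sorted into a decreasing chain
(`IsChainDiff.symmDiff_incl`).
-/

namespace DiffHier

/-! ### Unravelling sequences in a Boolean algebra -/

section Boolean

variable {B : Type*} [BooleanAlgebra B]

/-- The element `b` at odd indices and its complement at even ones. -/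
def sign (b : B) (j : ℕ) : B := if Odd j then b else bᶜ

theorem sign_succ (b : B) (j : ℕ) : sign b (j + 1) = (sign b j)ᶜ := by
  by_cases h : Odd j <;> simp [sign, Nat.odd_add_one, h]

theorem sign_one (b : B) : sign b 1 = b := by simp [sign]

theorem sign_of_odd (b : B) {j : ℕ} (h : Odd j) : sign b j = b := if_pos h

theorem sign_of_even (b : B) {j : ℕ} (h : Even j) : sign b j = bᶜ :=
  if_neg (Nat.not_odd_iff_even.2 h)

/-- The sequence `x 1 ≥ x 2 ≥ …` unravels `b`: it starts above `b`, and `x (j + 1)` contains the part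
of `x j` lying outside `b` (`j` odd) or inside `b` (`j` even). The value `x 0` is irrelevant. -/
structure Unravels (b : B) (x : ℕ → B) : Prop where
  antitoneOn : AntitoneOn x (Set.Ici 1)
  le_one : b ≤ x 1
  inf_sign_le : ∀ j, 1 ≤ j → x j ⊓ sign b (j + 1) ≤ x (j + 1)

theorem nestedDiff_le (x : ℕ → B) (k n : ℕ) : nestedDiff x k n ≤ x k := by
  cases n with
  | zero => exact bot_le
  | succ n => exact sdiff_le

theorem nestedDiff_congr {x y : ℕ → B} {k n : ℕ} (h : ∀ i, k ≤ i → i < k + n → x i = y i) :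
    nestedDiff x k n = nestedDiff y k n := by
  induction n generalizing k with
  | zero => rfl
  | succ n ih =>
    simp only [nestedDiff]
    rw [h k le_rfl (by lia), ih fun i h₁ h₂ => h i (by lia) (by lia)]

theorem nestedDiff_shift (x : ℕ → B) (k n : ℕ) :
    nestedDiff (fun i => x (i + 1)) k n = nestedDiff x (k + 1) n := by
  induction n generalizing k with
  | zero => rfl
  | succ n ih => simp only [nestedDiff, ih]

theorem nestedDiff_add_one_of_eq_bot {x : ℕ → B} {k n : ℕ} (h : x (k + n) = ⊥) :
    nestedDiff x k (n + 1) = nestedDiff x k n := by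
  induction n generalizing k with
  | zero => simpa [nestedDiff] using h
  | succ n ih =>
    have h' : x (k + 1 + n) = ⊥ := by rw [← h]; congr 1; lia
    rw [nestedDiff, ih h', nestedDiff]

/-- A tail of the iterated difference `b` is cut out of its first term by `b` or its complement. -/
theorem inf_sign_nestedDiff {x : ℕ → B} (hx : AntitoneOn x (Set.Ici 1)) {n : ℕ} (j : ℕ)
    (hj : j ≤ n) :
    x (j + 1) ⊓ sign (nestedDiff x 1 n) (j + 1) = nestedDiff x (j + 1) (n - j) := by
  induction j with
  | zero => simpa [sign_one] using nestedDiff_le x 1 n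
  | succ j ih =>
    have ih := ih (by lia)
    have hn : n - j = (n - (j + 1)) + 1 := by lia
    rw [hn, nestedDiff] at ih
    have hle : x (j + 1 + 1) ≤ x (j + 1) :=
      hx (by simp only [Set.mem_Ici]; lia) (by simp only [Set.mem_Ici]; lia) (by lia)
    generalize hN : nestedDiff x (j + 1 + 1) (n - (j + 1)) = N at ih ⊢
    have hNle : N ≤ x (j + 1 + 1) := hN ▸ nestedDiff_le ..
    rw [sign_succ, ← sdiff_eq]
    calc x (j + 1 + 1) \ sign (nestedDiff x 1 n) (j + 1)
        = x (j + 1 + 1) \ (x (j + 1) ⊓ sign (nestedDiff x 1 n) (j + 1)) := by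
          rw [sdiff_inf, sdiff_eq_bot_iff.2 hle, bot_sup_eq]
      _ = N := by
          rw [ih, sdiff_sdiff_right', sdiff_eq_bot_iff.2 hle, bot_sup_eq, inf_eq_right.2 hNle]

theorem Unravels.of_nestedDiff {x : ℕ → B} (hx : AntitoneOn x (Set.Ici 1)) {n : ℕ}
    (hn : x (n + 1) = ⊥) :
    Unravels (nestedDiff x 1 n) x where
  antitoneOn := hx
  le_one := nestedDiff_le ..
  inf_sign_le j hj := by
    obtain ⟨j, rfl⟩ := Nat.exists_eq_add_of_le' hj
    rcases le_or_gt n j with h | h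
    · have : x (j + 1) ≤ ⊥ := hn ▸ hx (by simp) (by simp) (by lia)
      exact inf_le_left.trans (this.trans bot_le)
    · have h₁ := inf_sign_nestedDiff hx j h.le
      have h₂ := nestedDiff_le x (j + 1 + 1) (n - (j + 1))
      rw [show n - j = (n - (j + 1)) + 1 by lia, nestedDiff] at h₁
      rw [sign_succ, ← sdiff_eq, ← sdiff_inf_self_left, h₁, sdiff_sdiff_right_self]
      exact inf_le_right.trans h₂

/-- The tails of an unravelling sequence that ends in zero, by induction from the zero backwards. -/
theorem Unravels.nestedDiff_eq {b : B} {x : ℕ → B} (hx : Unravels b x) {k n : ℕ} (hk : 1 ≤ k)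
    (hn : x (k + n) = ⊥) : nestedDiff x k n = x k ⊓ sign b k := by
  induction n generalizing k with
  | zero => simp_all [nestedDiff]
  | succ n ih =>
    have hn' : x (k + 1 + n) = ⊥ := by rw [← hn]; congr 1; lia
    have h := hx.inf_sign_le k hk
    rw [sign_succ, ← sdiff_eq] at h
    rw [nestedDiff, ih (by lia) hn', sign_succ, sdiff_inf, sdiff_compl]
    exact sup_eq_right.2 (le_inf sdiff_le (sdiff_le_comm.1 h))

theorem Unravels.eq_nestedDiff {b : B} {x : ℕ → B} (hx : Unravels b x) {n : ℕ}
    (hn : x (n + 1) = ⊥) : b = nestedDiff x 1 n := by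
  rw [hx.nestedDiff_eq le_rfl (by rwa [add_comm]), sign_one, inf_eq_right.2 hx.le_one]

theorem Unravels.pairJoin_eq {b : B} {x : ℕ → B} (hx : Unravels b x) (n : ℕ) :
    pairJoin x (n + 1) = b \ x (2 * (n + 1)) := by
  have hodd : ∀ i, x (2 * i + 1) \ x (2 * i + 2) ≤ b := fun i => by
    have := hx.inf_sign_le (2 * i + 1) (by lia)
    rwa [sign_of_even b (by simp [parity_simps]), ← sdiff_eq, sdiff_le_comm] at this
  induction n with
  | zero =>
    refine le_antisymm ?_ ?_
    · simpa [pairJoin] using le_sdiff.2 ⟨hodd 0, disjoint_sdiff_self_left⟩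
    · simpa [pairJoin] using sdiff_le_sdiff_right hx.le_one
  | succ n ih =>
    have hstep : pairJoin x (n + 1 + 1) =
        pairJoin x (n + 1) ⊔ x (2 * (n + 1) + 1) \ x (2 * (n + 1) + 2) := by
      rw [pairJoin, ← Finset.insert_Icc_right_eq_Icc_add_one (by lia), Finset.sup_insert, sup_comm]
      rfl
    have hanti : x (2 * (n + 1) + 2) ≤ x (2 * (n + 1)) :=
      hx.antitoneOn (by simp only [Set.mem_Ici]; lia) (by simp only [Set.mem_Ici]; lia) (by lia)
    have heven := hx.inf_sign_le (2 * (n + 1)) (by lia)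
    rw [sign_of_odd b (by simp [parity_simps])] at heven
    rw [hstep, ih, show 2 * (n + 1 + 1) = 2 * (n + 1) + 2 by lia]
    refine le_antisymm (sup_le (sdiff_le_sdiff_left hanti)
      (le_sdiff.2 ⟨hodd _, disjoint_sdiff_self_left⟩)) ?_
    calc b \ x (2 * (n + 1) + 2)
        = (b \ x (2 * (n + 1)) ⊔ x (2 * (n + 1)) ⊓ b) \ x (2 * (n + 1) + 2) := by
          rw [inf_comm, sup_comm, sup_inf_sdiff]
      _ ≤ _ := by
          rw [sup_sdiff]
          exact sup_le_sup sdiff_le (sdiff_le_sdiff_right heven)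

end Boolean

/-! ### Every element of the Booleanization is an iterated difference -/

section Representation

open scoped symmDiff

variable {D : Type*} [DistribLattice D] [BoundedOrder D]

/-- `IsChainDiff u b` says that `b = c₁ - (c₂ - (⋯ - cₙ))` for some chain `u ≥ c₁ ≥ ⋯ ≥ cₙ` in `D`. -/
inductive IsChainDiff : D → Booleanization D → Prop
  | bot (u : D) : IsChainDiff u ⊥
  | sdiff {u c : D} {x : Booleanization D} : c ≤ u → IsChainDiff c x → IsChainDiff u (incl D c \ x)

namespace IsChainDiff

variable {u v c : D} {x y : Booleanization D}

theorem mono (h : IsChainDiff u x) (huv : u ≤ v) : IsChainDiff v x := by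
  cases h with
  | bot => exact .bot v
  | sdiff hc hx => exact .sdiff (hc.trans huv) hx

theorem le_incl (h : IsChainDiff u x) : x ≤ incl D u := by
  cases h with
  | bot => exact bot_le
  | sdiff hc _ => exact sdiff_le.trans (incl_le_incl_iff.2 hc)

theorem sdiff_eq_symmDiff (h : IsChainDiff c x) : incl D c \ x = incl D c ∆ x := by
  rw [symmDiff_of_ge h.le_incl]

/-- Sorting a new summand into a chain: the first term `c` becomes `c ⊔ y`, and `c ⊓ y` is passed on
to the rest of the chain. -/
theorem symmDiff_incl (h : IsChainDiff u x) (y : D) : IsChainDiff (u ⊔ y) (x ∆ incl D y) := by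
  induction h generalizing y with
  | bot u =>
    have := IsChainDiff.sdiff (u := u ⊔ y) le_sup_right (.bot y)
    simpa using this
  | @sdiff u c x hc hx ih =>
    have h := ih (c ⊓ y)
    rw [sup_inf_self] at h
    have h' := h.mono (le_sup_left : c ≤ c ⊔ y)
    have hsum : (incl D c \ x) ∆ incl D y = incl D (c ⊔ y) \ (x ∆ incl D (c ⊓ y)) := by
      rw [hx.sdiff_eq_symmDiff, h'.sdiff_eq_symmDiff, map_sup, map_inf, symmDiff_comm x,
        ← symmDiff_assoc, symmDiff_of_ge (inf_le_left.trans le_sup_left), ← symmDiff_eq_sup_sdiff_inf,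
        symmDiff_right_comm]
    rw [hsum]
    exact .sdiff (sup_le_sup_right hc y) h'

theorem symmDiff (hx : IsChainDiff u x) (hy : IsChainDiff v y) : IsChainDiff ⊤ (x ∆ y) := by
  induction hy generalizing u x with
  | bot => simpa using hx.mono le_top
  | sdiff _ hy ih =>
    rw [hy.sdiff_eq_symmDiff, ← symmDiff_assoc]
    exact ih (hx.symmDiff_incl _)

theorem inf_incl (hx : IsChainDiff u x) (d : D) : IsChainDiff u (x ⊓ incl D d) := by
  suffices h : IsChainDiff (u ⊓ d) (x ⊓ incl D d) from h.mono inf_le_left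
  induction hx with
  | bot => simpa using .bot _
  | sdiff hc _ ih =>
    rw [inf_sdiff_distrib_right, ← map_inf]
    exact .sdiff (inf_le_inf_right d hc) ih

theorem inf (hx : IsChainDiff u x) (hy : IsChainDiff v y) : IsChainDiff ⊤ (x ⊓ y) := by
  induction hy with
  | bot => simpa using .bot _
  | sdiff _ hy ih =>
    rw [hy.sdiff_eq_symmDiff, inf_symmDiff_distrib_left]
    exact (hx.inf_incl _).symmDiff ih

theorem sup (hx : IsChainDiff u x) (hy : IsChainDiff v y) : IsChainDiff ⊤ (x ⊔ y) := by
  rw [← symmDiff_symmDiff_inf]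
  exact (hx.symmDiff hy).symmDiff (hx.inf hy)

/-- The sequence form of a chain; its term of index `0` records the upper bound. -/
theorem exists_nestedDiff (h : IsChainDiff u x) : ∃ (n : ℕ) (c : ℕ → D), c 0 = u ∧ Antitone c ∧
    (∀ i, n < i → c i = ⊥) ∧ x = nestedDiff (fun i => incl D (c i)) 1 n := by
  induction h with
  | bot u =>
    refine ⟨0, fun i => if i = 0 then u else ⊥, rfl, antitone_nat_of_succ_le fun i => by simp,
      fun i hi => if_neg hi.ne', rfl⟩
  | @sdiff v u x hc _ ih =>
    obtain ⟨n, c, rfl, hanti, hbot, rfl⟩ := ih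
    refine ⟨n + 1, fun i => i.casesOn v c, rfl, antitone_nat_of_succ_le ?_, ?_, ?_⟩
    · rintro (_ | i)
      · exact hc
      · exact hanti i.le_succ
    · rintro (_ | i) hi
      · lia
      · exact hbot i (by lia)
    · exact congrArg (incl D (c 0) \ ·) (nestedDiff_shift (fun i => incl D (i.casesOn v c)) 1 n)

end IsChainDiff

theorem isChainDiff_top (b : Booleanization D) : IsChainDiff ⊤ b := by
  induction b using Booleanization.induction with
  | sdiff a b =>
    have h : IsChainDiff ⊤ (incl D a \ (incl D (a ⊓ b) \ ⊥)) :=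
      .sdiff le_top (.sdiff inf_le_left (.bot _))
    rwa [sdiff_bot, map_inf, sdiff_inf_self_left] at h
  | sup x y hx hy => exact hx.sup hy

theorem exists_eq_nestedDiff_two_mul (b : Booleanization D) : ∃ (p : ℕ) (c : ℕ → D), 1 ≤ p ∧
    Antitone c ∧ b = nestedDiff (fun i => incl D (c i)) 1 (2 * p) := by
  -- A chain is brought to positive even length by appending zeros.
  obtain ⟨n, c, -, hanti, hbot, hb⟩ := (isChainDiff_top b).exists_nestedDiff
  have hpad : ∀ k, b = nestedDiff (fun i => incl D (c i)) 1 (n + k) := fun k => by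
    induction k with
    | zero => exact hb
    | succ k ih =>
      rw [← add_assoc, nestedDiff_add_one_of_eq_bot, ← ih]
      rw [hbot _ (by lia), map_bot]
  refine ⟨n + 1, c, by lia, hanti, ?_⟩
  rw [show 2 * (n + 1) = n + (n + 2) by lia]
  exact hpad _

end Representation

/-! ### The canonical sequence -/

section Ceil

variable {D : Type*} [CoheytingAlgebra D] {b : Booleanization D} {a : ℕ → D}

theorem unravels_ceil_sequence (h_one : a 1 = ceil b)
    (h_succ : ∀ j, 1 ≤ j → a (j + 1) = ceil (incl D (a j) ⊓ sign b (j + 1))) :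
    Unravels b fun i => incl D (a i) where
  antitoneOn := antitoneOn_of_succ_le Set.ordConnected_Ici fun j _ hj _ => by
    rw [Nat.succ_eq_succ, Nat.succ_eq_add_one, h_succ j hj, incl_le_incl_iff]
    exact (ceil_gc _ _).2 inf_le_left
  le_one := h_one ▸ ceil_gc.le_u_l b
  inf_sign_le j hj := by
    rw [h_succ j hj]
    exact ceil_gc.le_u_l _

theorem ceil_sequence_le (h_one : a 1 = ceil b)
    (h_succ : ∀ j, 1 ≤ j → a (j + 1) = ceil (incl D (a j) ⊓ sign b (j + 1))) {c : ℕ → D}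
    (hc : Unravels b fun i => incl D (c i)) {j : ℕ} (hj : 1 ≤ j) : a j ≤ c j := by
  induction j, hj using Nat.le_induction with
  | base =>
    rw [h_one]
    exact (ceil_gc _ _).2 hc.le_one
  | succ j hj ih =>
    rw [h_succ j hj]
    exact (ceil_gc _ _).2
      ((inf_le_inf_right _ (incl_le_incl_iff.2 ih)).trans (hc.inf_sign_le j hj))

/-- A representation of `b` of length `n`, continued by zeros, unravels `b`. -/
theorem unravels_ite_of_eq_nestedDiff {c : ℕ → D} {n : ℕ} (hc : AntitoneOn c (Set.Icc 1 n))
    (hb : b = nestedDiff (fun i => incl D (c i)) 1 n) :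
    Unravels b fun i => incl D (if i ≤ n then c i else ⊥) := by
  have hb' : b = nestedDiff (fun i => incl D (if i ≤ n then c i else ⊥)) 1 n := by
    rw [hb]
    exact nestedDiff_congr fun i _ hi => by rw [if_pos (by lia)]
  rw [hb']
  refine .of_nestedDiff (fun i hi j hj hij => ?_) (by simp)
  rw [incl_le_incl_iff]
  by_cases h : j ≤ n
  · rw [if_pos h, if_pos (hij.trans h)]
    exact hc ⟨hi, hij.trans h⟩ ⟨hj, h⟩ hij
  · rw [if_neg h]
    exact bot_le

end Ceil

end DiffHier

open DiffHier
theorem corollaryc {D : Type*} [CoheytingAlgebra D] (b : Booleanization D) (a : ℕ → D)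
    (h_one : a 1 = ceil b)
    (h_even : ∀ i, 1 ≤ i → a (2 * i) = ceil (incl D (a (2 * i - 1)) \ b))
    (h_odd : ∀ i, 1 ≤ i → a (2 * i + 1) = ceil (incl D (a (2 * i)) ⊓ b)) :
    AntitoneOn a (Set.Ici 1) ∧
    ∃ m : ℕ, IsLeast {k : ℕ | 1 ≤ k ∧ a (2 * k + 1) = ⊥} m ∧
      (∀ j, 2 * m + 1 ≤ j → a j = ⊥) ∧
      b = nestedDiff (fun i => incl D (a i)) 1 (2 * m) ∧
      ∀ (p : ℕ) (c : ℕ → D), 1 ≤ p → AntitoneOn c (Set.Icc 1 (2 * p)) →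
        b = nestedDiff (fun i => incl D (c i)) 1 (2 * p) →
        m ≤ p ∧
        (∀ i ∈ Set.Icc 1 (2 * p), a i ≤ c i) ∧
        ∀ n ≤ m, pairJoin (fun i => incl D (c i)) n ≤ pairJoin (fun i => incl D (a i)) n := by
  have h_succ : ∀ j, 1 ≤ j → a (j + 1) = ceil (incl D (a j) ⊓ sign b (j + 1)) := by
    intro j hj
    obtain ⟨i, rfl | rfl⟩ := Nat.even_or_odd' j
    · rw [sign_of_odd b (by simp), h_odd i (by lia)]
    · rw [sign_of_even b (by simp [parity_simps]), ← sdiff_eq]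
      exact h_even (i + 1) (by lia)
  have ha := unravels_ceil_sequence h_one h_succ
  have hanti : AntitoneOn a (Set.Ici 1) := fun i hi j hj hij =>
    incl_le_incl_iff.1 (ha.antitoneOn hi hj hij)
  -- The canonical sequence vanishes right after the end of any representation.
  have hvanish : ∀ (p : ℕ) (c : ℕ → D), AntitoneOn c (Set.Icc 1 (2 * p)) →
      b = nestedDiff (fun i => incl D (c i)) 1 (2 * p) → a (2 * p + 1) = ⊥ := by
    intro p c hc hb
    have h := ceil_sequence_le h_one h_succ (unravels_ite_of_eq_nestedDiff hc hb)
      (show 1 ≤ 2 * p + 1 by lia)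
    rwa [if_neg (by lia), le_bot_iff] at h
  have hne : ∃ k, 1 ≤ k ∧ a (2 * k + 1) = ⊥ := by
    obtain ⟨p, c, hp, hc, hb⟩ := exists_eq_nestedDiff_two_mul b
    exact ⟨p, hp, hvanish p c (hc.antitoneOn _) hb⟩
  classical
  have hm := Nat.find_spec hne
  have hmin : ∀ k, 1 ≤ k ∧ a (2 * k + 1) = ⊥ → Nat.find hne ≤ k := fun k => Nat.find_min' hne
  generalize Nat.find hne = m at hm hmin
  refine ⟨hanti, m, ⟨hm, fun k => hmin k⟩, fun j hj => ?_, ?_, fun p c hp hc hb => ?_⟩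
  · exact le_bot_iff.1 (hm.2 ▸ hanti (by simp) (by simp only [Set.mem_Ici]; lia) hj)
  · exact ha.eq_nestedDiff (by rw [hm.2, map_bot])
  · have hu := unravels_ite_of_eq_nestedDiff hc hb
    have hle : ∀ i ∈ Set.Icc 1 (2 * p), a i ≤ c i := fun i hi => by
      have h := ceil_sequence_le h_one h_succ hu hi.1
      rwa [if_pos hi.2] at h
    have hmp : m ≤ p := hmin p ⟨hp, hvanish p c hc hb⟩
    refine ⟨hmp, hle, fun n hn => ?_⟩
    obtain _ | n := n
    · simp [pairJoin]
    have hcongr : pairJoin (fun i => incl D (c i)) (n + 1) =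
        pairJoin (fun i => incl D (if i ≤ 2 * p then c i else ⊥)) (n + 1) := by
      refine Finset.sup_congr rfl fun i hi => ?_
      rw [Finset.mem_Icc] at hi
      simp only
      rw [if_pos (by lia), if_pos (by lia)]
    rw [hcongr, hu.pairJoin_eq, ha.pairJoin_eq, if_pos (by lia)]
    exact sdiff_le_sdiff_left (incl_le_incl_iff.2 (hle _ ⟨by lia, by lia⟩))
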